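/- A permutation of order $n$ is a bijection $\sigma$ of $[n]=\{1,\dots,n\}$ onto itself; we write $|\sigma|=n$. It is non-trivial if $n>1$, and indecomposable if there is no $m$ with $1\le m<n$ and $\sigma([m])=[m]$. Let $\pi$ be a permutation of order $k$ and $\sigma$ a permutation of order $n$. Let $\Lambda(\pi,\sigma)$ be the number of strictly increasing maps $f:[k]\to[n]$ such that, for all $i,j\in[k]$, $\pi(i)>\pi(j)$ if and only if $\sigma(f(i))>\sigma(f(j))$. Let $\Lambda_{\mathrm{mon}}(\pi,\sigma)$ be the number of strictly increasing maps $f:[k]\to[n]$ such that $\sigma(f(i))>\sigma(f(j))$ whenever $i<j$ and $\pi(i)>\pi(j)$. The density and the monomorphism density of $\pi$ in $\sigma$ are $t(\pi,\sigma)=\Lambda(\pi,\sigma)\binom nk^{-1}$ and $t_{\mathrm{mon}}(\pi,\sigma)=\Lambda_{\mathrm{mon}}(\pi,\sigma)\binom nk^{-1}$ if $k\le n$, and both are $0$ if $k>n$. For an integer $q$ let $\tau_1,\dots,\tau_r$ be all the non-trivial indecomposable permutations of order at most $q$. Let $T^q\subseteq\mathbb R^r$ be the set of all $\mathbf v\in\mathbb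 R^r$ for which there is a sequence of permutations $\sigma_1,\sigma_2,\dots$ with $|\sigma_n|\to\infty$ and $(t(\tau_1,\sigma_n),\dots,t(\tau_r,\sigma_n))\to\mathbf v$. Let $T^q_{\mathrm{mon}}\subseteq\mathbb R^r$ be defined in the same way, with $t_{\mathrm{mon}}$ in place of $t$. Theorem. For every integer $q\ge 2$ there exist a vector $\mathbf w\in T^q$ and $\varepsilon>0$ such that the Euclidean ball $B(\mathbf w,\varepsilon)$ is contained in $T^q$. In particular, $T^q$ has non-empty interior, and the densities are independent: for no $i\in\{1,\dots,r\}$ is there a function $g:\mathbb R^{r-1}\to\mathbb R$ such that $v_i=g(v_1,\dots,v_{i-1},v_{i+1},\dots,v_r)$ for all $\mathbf v\in T^q$. The same statements hold with $T^q_{\mathrm{mon}}$ in place of $T^q$. -/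

import Mathlib

open Filter Topology

/-- The permutation `σ` of order `n` is indecomposable: there is no `1 ≤ m < n` such that `σ` maps
the set of the first `m` elements onto itself. -/
def IsIndecomposable {n : ℕ} (σ : Equiv.Perm (Fin n)) : Prop :=
  ¬ ∃ m : ℕ, 1 ≤ m ∧ m < n ∧
    σ '' {i : Fin n | (i : ℕ) < m} = {i : Fin n | (i : ℕ) < m}

/-- The set of occurrences of `π` as a subpermutation of `σ`. -/
def Occ {k n : ℕ} (π : Equiv.Perm (Fin k)) (σ : Equiv.Perm (Fin n)) : Set (Fin k → Fin n) :=
  {f | StrictMono f ∧ ∀ i j : Fin k, π i > π j ↔ σ (f i) > σ (f j)}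

/-- The set of homomorphisms of `π` to `σ`: the non-decreasing maps that preserve inversions. -/
def Hom {k n : ℕ} (π : Equiv.Perm (Fin k)) (σ : Equiv.Perm (Fin n)) : Set (Fin k → Fin n) :=
  {f | Monotone f ∧ ∀ i j : Fin k, i < j → π i > π j → σ (f i) > σ (f j)}

/-- The set of monomorphisms of `π` to `σ`: the injective homomorphisms. -/
def Mon {k n : ℕ} (π : Equiv.Perm (Fin k)) (σ : Equiv.Perm (Fin n)) : Set (Fin k → Fin n) :=
  {f | f ∈ Hom π σ ∧ Function.Injective f}

/-- The (subpermutation) density `t(π, σ)`. -/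
noncomputable def density {k n : ℕ} (π : Equiv.Perm (Fin k)) (σ : Equiv.Perm (Fin n)) : ℝ :=
  if k ≤ n then ((Occ π σ).ncard : ℝ) / (n.choose k : ℝ) else 0

/-- The monomorphism density `t_mon(π, σ)`. -/
noncomputable def monDensity {k n : ℕ} (π : Equiv.Perm (Fin k)) (σ : Equiv.Perm (Fin n)) : ℝ :=
  if k ≤ n then ((Mon π σ).ncard : ℝ) / (n.choose k : ℝ) else 0

/-- The set `{τ₁, …, τᵣ}` of all non-trivial (order greater than `1`) indecomposable permutations
of order at most `q`, as a type. -/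
abbrev IndecPerm (q : ℕ) : Type :=
  {τ : (k : Fin (q + 1)) × Equiv.Perm (Fin (k : ℕ)) // 1 < (τ.1 : ℕ) ∧ IsIndecomposable τ.2}

noncomputable instance (q : ℕ) : Fintype (IndecPerm q) := Fintype.ofFinite _

/-- The vector `𝐭^q(σ)` of the densities in `σ` of the non-trivial indecomposable permutations of
order at most `q`. -/
noncomputable def densityVec (q : ℕ) {n : ℕ} (σ : Equiv.Perm (Fin n)) :
    EuclideanSpace ℝ (IndecPerm q) :=
  WithLp.toLp 2 (fun τ => density τ.1.2 σ)

/-- The vector `𝐭^q_mon(σ)` of the monomorphism densities in `σ`. -/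
noncomputable def monDensityVec (q : ℕ) {n : ℕ} (σ : Equiv.Perm (Fin n)) :
    EuclideanSpace ℝ (IndecPerm q) :=
  WithLp.toLp 2 (fun τ => monDensity τ.1.2 σ)

/-- The set `T^q` of the limits of the vectors `𝐭^q(σ_n)` over sequences of permutations `σ_n`
whose orders `N n` tend to infinity. -/
def limitDensities (q : ℕ) : Set (EuclideanSpace ℝ (IndecPerm q)) :=
  {v | ∃ (N : ℕ → ℕ) (σ : (n : ℕ) → Equiv.Perm (Fin (N n))),
    Tendsto N atTop atTop ∧ Tendsto (fun n => densityVec q (σ n)) atTop (𝓝 v)}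

/-- The set `T^q_mon` of the limits of the vectors `𝐭^q_mon(σ_n)` over sequences of permutations
`σ_n` whose orders `N n` tend to infinity. -/
def limitMonDensities (q : ℕ) : Set (EuclideanSpace ℝ (IndecPerm q)) :=
  {v | ∃ (N : ℕ → ℕ) (σ : (n : ℕ) → Equiv.Perm (Fin (N n))),
    Tendsto N atTop atTop ∧ Tendsto (fun n => monDensityVec q (σ n)) atTop (𝓝 v)}

/-- The coordinates are independent on `T`: none of them can be expressed on `T` as a function of
the other ones. -/
def CoordsIndependent {ι : Type*} (T : Set (EuclideanSpace ℝ ι)) : Prop :=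
  ∀ i : ι, ¬ ∃ g : ({j : ι // j ≠ i} → ℝ) → ℝ, ∀ v ∈ T, v i = g (fun j => v j.1)

/-!
Occurrence counts of an indecomposable permutation are additive under direct sums: an indecomposable
`π` has an inversion across every cut of its domain (`IsIndecomposable.exists_inversion`), so no
occurrence can meet two summands (`exists_perm_directSum`). Rescaling the size of a summand by `z`
multiplies the limiting number of occurrences of a permutation of order `k` by `z ^ k`. Hence, if
`u₁, …, uₛ` are limit vectors of normalized counts, then, with `k` the order of `τ`,
`z ↦ (k! * ∑ᵢ zᵢ ^ k * uᵢ(τ))_τ` takes values in `limitDensities q` for all small positive `z`; the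
missing mass is filled with an identity permutation, which contains no non-trivial indecomposable
one. At a point with equal positive coordinates the derivative of this map is, up to an invertible
diagonal factor, the linear map with columns `uᵢ`. It is therefore surjective as soon as the `uᵢ`
span, and then the image contains a neighbourhood (`exists_mem_nhds_limitDensities`).

That the limit vectors span is seen on inflations of `τ₀` by increasing runs of lengths proportional
to weights `w a`. The limiting number of occurrences of `τ` is a polynomial in the weights, and the
squarefree monomial containing all weights occurs in it only if `τ = τ₀`
(`eq_of_fiberCard_eq_one`). A linear functional that vanishes on all limit vectors thus has
zero coefficient at every `τ₀` (`coeff_eq_zero_of_forall_sum_eq_zero`).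

The monomorphism density of `π` is the sum of the densities of the permutations of the same order
whose inversion sets contain that of `π`, and these are again indecomposable. So the vector of
monomorphism densities is the image of the vector of densities under a linear map that is
unitriangular with respect to inclusion of inversion sets (`monDensityVec_eq`, `monMap_injective`),
and the neighbourhood is transported by this isomorphism. Independence of the coordinates follows
from having an interior point.
-/

/-! ### Occurrences in finite point configurations and in direct sums -/

/-- Occurrences of `π` in a configuration of points given by a linearly ordered set `X` of
positions and a height function `y`. For `y = σ` a permutation this is `Occ π σ`. -/
def PatternMaps {k : ℕ} (π : Equiv.Perm (Fin k)) {X V : Type*} [LinearOrder X] [LinearOrder V]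
    (y : X → V) : Set (Fin k → X) :=
  {f | StrictMono f ∧ ∀ i j : Fin k, π i > π j ↔ y (f i) > y (f j)}

/-- Every finite point configuration with distinct heights is realized by a permutation with the
same number of occurrences of every pattern. -/
theorem exists_perm_ncard_occ_eq {X V : Type*} [LinearOrder X] [Fintype X] [LinearOrder V]
    (y : X → V) (hy : Function.Injective y) {N : ℕ} (hN : Fintype.card X = N) :
    ∃ σ : Equiv.Perm (Fin N), ∀ (k : ℕ) (π : Equiv.Perm (Fin k)),
      (Occ π σ).ncard = (PatternMaps π y).ncard := by
  classical
  let e := Fintype.orderIsoFinOfCardEq X hN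
  have hc : (Finset.univ.image y).card = N := by
    rw [Finset.card_image_of_injective _ hy, Finset.card_univ, hN]
  let e' := (Finset.univ.image y).orderIsoOfFin hc
  let s : Fin N → Fin N :=
    fun i => e'.symm ⟨y (e i), Finset.mem_image_of_mem _ (Finset.mem_univ _)⟩
  have hs : ∀ i j, s i < s j ↔ y (e i) < y (e j) := by
    intro i j
    simp only [s, OrderIso.lt_iff_lt, Subtype.mk_lt_mk]
  have hinj : Function.Injective s := by
    intro i j h
    have h1 := (hs i j).not.mp (by simp [h])
    have h2 := (hs j i).not.mp (by simp [h])
    exact e.injective (hy (le_antisymm (not_lt.mp h2) (not_lt.mp h1)))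
  refine ⟨Equiv.ofBijective s (Finite.injective_iff_bijective.mp hinj), fun k π => ?_⟩
  refine Set.ncard_congr (fun f _ => e ∘ f) ?_ ?_ ?_
  · rintro f ⟨hf, hf'⟩
    refine ⟨e.strictMono.comp hf, fun i j => ?_⟩
    rw [hf' i j]
    exact hs _ _
  · intro f g _ _ h
    exact e.injective.comp_left h
  · rintro g ⟨hg, hg'⟩
    refine ⟨e.symm ∘ g, ⟨e.symm.strictMono.comp hg, fun i j => ?_⟩, ?_⟩
    · rw [hg' i j]
      refine Iff.trans ?_ (hs _ _).symm
      simp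
    · ext i
      simp

theorem finite_occ {k n : ℕ} (π : Equiv.Perm (Fin k)) (σ : Equiv.Perm (Fin n)) :
    (Occ π σ).Finite := Set.toFinite _

/-- An indecomposable permutation has an inversion across every cut of its domain. -/
theorem IsIndecomposable.exists_inversion {k : ℕ} {π : Equiv.Perm (Fin k)}
    (hπ : IsIndecomposable π) {m : ℕ} (hm : 1 ≤ m) (hmk : m < k) :
    ∃ i j : Fin k, (i : ℕ) < m ∧ m ≤ (j : ℕ) ∧ π j < π i := by
  by_contra! hcon
  refine hπ ⟨m, hm, hmk, ?_⟩
  -- The initial segment is mapped to a lower set, and a lower set is determined by its size.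
  have hsub : π '' {i : Fin k | (i : ℕ) < m} ⊆ {i : Fin k | (i : ℕ) < m} := by
    rintro _ ⟨i, hi, rfl⟩
    by_contra hge
    have hge : m ≤ (π i : ℕ) := not_lt.mp hge
    have h1 : (Finset.univ.filter fun j : Fin k => m ≤ (j : ℕ)).image π ⊆
        Finset.univ.filter fun j : Fin k => m < (j : ℕ) := by
      intro x hx
      obtain ⟨j, hj, rfl⟩ := Finset.mem_image.mp hx
      have hj : m ≤ (j : ℕ) := by simpa using hj
      have hlt : π i < π j := by
        refine lt_of_le_of_ne (hcon i j hi hj) fun h => ?_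
        have := π.injective h
        subst this
        exact absurd hi (not_lt.mpr hj)
      simpa using lt_of_le_of_lt hge (Fin.lt_def.mp hlt)
    have h2 := Finset.card_le_card h1
    rw [Finset.card_image_of_injective _ π.injective] at h2
    refine absurd (Finset.card_lt_card ?_) (not_lt.mpr h2)
    refine (Finset.ssubset_iff_of_subset ?_).mpr ⟨⟨m, hmk⟩, ?_, ?_⟩
    · intro j hj
      simp only [Finset.mem_filter, Finset.mem_univ, true_and] at hj ⊢
      exact hj.le
    · simp
    · simp
  refine Set.eq_of_subset_of_ncard_le hsub ?_
  rw [Set.ncard_image_of_injective _ π.injective]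

theorem IsIndecomposable.of_inversions_subset {k : ℕ} {π ρ : Equiv.Perm (Fin k)}
    (hπ : IsIndecomposable π) (h : ∀ i j, i < j → π i > π j → ρ i > ρ j) :
    IsIndecomposable ρ := by
  rintro ⟨m, hm, hmk, hρ⟩
  obtain ⟨i, j, hi, hj, hij⟩ := hπ.exists_inversion hm hmk
  have h1 := h i j (Fin.lt_def.mpr (hi.trans_le hj)) hij
  have h2 : ρ i ∈ {i : Fin k | (i : ℕ) < m} := hρ ▸ Set.mem_image_of_mem ρ hi
  have h3 : ρ j ∈ {i : Fin k | (i : ℕ) < m} := lt_trans (Fin.lt_def.mp h1) h2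
  rw [← hρ] at h3
  obtain ⟨j', hj', h4⟩ := h3
  rw [ρ.injective h4] at hj'
  exact absurd hj' (not_lt.mpr hj)

/-- A permutation is determined by its inversions. -/
theorem perm_eq_of_inversions {k : ℕ} {π ρ : Equiv.Perm (Fin k)}
    (h : ∀ i j, i < j → (π i > π j ↔ ρ i > ρ j)) : π = ρ := by
  have key : ∀ i j, π i < π j ↔ ρ i < ρ j := by
    intro i j
    rcases lt_trichotomy i j with hij | rfl | hij
    · have := (h i j hij).not
      have h1 := π.injective.ne hij.ne
      have h2 := ρ.injective.ne hij.ne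
      grind
    · simp
    · exact h j i hij
  have hmono : StrictMono (fun x => ρ (π.symm x)) := by
    intro a b hab
    exact (key _ _).mp (by simpa using hab)
  have hid : (fun x => ρ (π.symm x)) = id :=
    hmono.range_inj strictMono_id |>.mp (by
      rw [Set.range_id]
      exact (π.symm.trans ρ).surjective.range_eq)
  ext i
  have := congrFun hid (π i)
  simp at this
  rw [this]

/-- Occurrences of an indecomposable permutation in a direct sum lie in one of the summands. -/
theorem exists_perm_directSum {m n : ℕ} (σ : Equiv.Perm (Fin m)) (ρ : Equiv.Perm (Fin n)) :
    ∃ θ : Equiv.Perm (Fin (m + n)), ∀ (k : ℕ) (π : Equiv.Perm (Fin k)), 1 ≤ k →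
      IsIndecomposable π → (Occ π θ).ncard = (Occ π σ).ncard + (Occ π ρ).ncard := by
  let y : Fin m ⊕ₗ Fin n → Fin m ⊕ₗ Fin n := fun x => toLex (Sum.map σ ρ (ofLex x))
  have hy : Function.Injective y := by
    intro a b h
    exact ofLex.injective ((Sum.map_injective.mpr ⟨σ.injective, ρ.injective⟩) (toLex.injective h))
  have hcard : Fintype.card (Fin m ⊕ₗ Fin n) = m + n := by
    rw [Fintype.card_lex, Fintype.card_sum, Fintype.card_fin, Fintype.card_fin]
  obtain ⟨θ, hθ⟩ := exists_perm_ncard_occ_eq y hy hcard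
  refine ⟨θ, fun k π hk hπ => ?_⟩
  rw [hθ]
  have hl : Function.Injective (fun (f : Fin k → Fin m) i => (Sum.inlₗ (f i) : Fin m ⊕ₗ Fin n)) := by
    intro f g h
    funext i
    have := congrFun h i
    simpa [Sum.inlₗ] using this
  have hr : Function.Injective (fun (f : Fin k → Fin n) i => (Sum.inrₗ (f i) : Fin m ⊕ₗ Fin n)) := by
    intro f g h
    funext i
    have := congrFun h i
    simpa [Sum.inrₗ] using this
  rw [← Set.ncard_image_of_injective (Occ π σ) hl, ← Set.ncard_image_of_injective (Occ π ρ) hr,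
    ← Set.ncard_union_eq ?_ (Set.toFinite _) (Set.toFinite _)]
  · congr 1
    ext f
    constructor
    · rintro ⟨hf, hf'⟩
      by_cases hR : ∃ i, (ofLex (f i)).isRight
      · -- The first index mapped to the second summand would be a cut without inversions across it.
        obtain ⟨j₀, hj₀, hmin⟩ := WellFounded.has_min (wellFounded_lt (α := Fin k))
          {i | (ofLex (f i)).isRight} hR
        have hright : ∀ j, j₀ ≤ j → (ofLex (f j)).isRight := by
          intro j hj
          have hle := hf.monotone hj
          obtain ⟨b, hb⟩ := Sum.isRight_iff.mp hj₀
          rcases hfj : ofLex (f j) with a | a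
          · rw [← toLex_ofLex (f j), ← toLex_ofLex (f j₀), hb, hfj] at hle
            simp at hle
          · rfl
        have hzero : (j₀ : ℕ) = 0 := by
          by_contra hne
          obtain ⟨i, j, hi, hj, hij⟩ :=
            hπ.exists_inversion (Nat.one_le_iff_ne_zero.mpr hne) j₀.isLt
          have hgt := (hf' i j).mp hij
          obtain ⟨b, hb⟩ := Sum.isRight_iff.mp (hright j (Fin.le_def.mpr hj))
          have hl : ¬ (ofLex (f i)).isRight := fun h => hmin i h (Fin.lt_def.mpr hi)
          rcases hfi : ofLex (f i) with a | a
          · simp [y, hb, hfi] at hgt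
          · simp [hfi] at hl
        have hall : ∀ j, ∃ b, f j = toLex (Sum.inr b) := fun j =>
          Sum.isRight_iff.mp (hright j (Fin.le_def.mpr (by omega)))
        choose g hg using hall
        obtain rfl : f = fun j => Sum.inrₗ (g j) := funext hg
        refine Or.inr ⟨g, ⟨fun i j hij => ?_, fun i j => ?_⟩, rfl⟩
        · simpa [Sum.inrₗ] using hf hij
        · simpa [Sum.inrₗ, y] using hf' i j
      · have hall : ∀ j, ∃ b, f j = toLex (Sum.inl b) := fun j =>
          Sum.isLeft_iff.mp (Sum.not_isRight.mp fun h => hR ⟨j, h⟩)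
        choose g hg using hall
        obtain rfl : f = fun j => Sum.inlₗ (g j) := funext hg
        refine Or.inl ⟨g, ⟨fun i j hij => ?_, fun i j => ?_⟩, rfl⟩
        · simpa [Sum.inlₗ] using hf hij
        · simpa [Sum.inlₗ, y] using hf' i j
    · rintro (⟨f, ⟨hf, hf'⟩, rfl⟩ | ⟨f, ⟨hf, hf'⟩, rfl⟩)
      · refine ⟨fun i j hij => ?_, fun i j => ?_⟩
        · simpa [Sum.inlₗ] using hf hij
        · simpa [Sum.inlₗ, y] using hf' i j
      · refine ⟨fun i j hij => ?_, fun i j => ?_⟩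
        · simpa [Sum.inrₗ] using hf hij
        · simpa [Sum.inrₗ, y] using hf' i j
  · rw [Set.disjoint_left]
    rintro _ ⟨f, _, rfl⟩ ⟨g, _, h⟩
    have := congrFun h ⟨0, hk⟩
    simp [Sum.inlₗ, Sum.inrₗ] at this

/-! ### Counting occurrences in inflations by increasing runs -/

theorem card_orderEmbedding_fin (α : Type*) [LinearOrder α] [Fintype α] (m : ℕ) :
    Nat.card (α ↪o Fin m) = m.choose (Fintype.card α) := by
  have h : (α ↪o Fin m) ≃ (Fin (Fintype.card α) ↪o Fin m) :=
    OrderIso.orderEmbeddingCongr (Fintype.orderIsoFinOfCardEq α rfl).symm (OrderIso.refl _)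
  rw [Nat.card_congr (h.trans Set.powersetCard.ofFinEmbEquiv), Set.powersetCard.card, Nat.card_fin]

/-- The number of indices that `g` maps to `a`. -/
def fiberCard {k s : ℕ} (g : Fin k → Fin s) (a : Fin s) : ℕ := Fintype.card {i : Fin k // g i = a}

/-- Maps to the blocks of an inflation of `ρ` that can underlie an occurrence of `π`, where several
indices may be mapped to the same block. Two indices in the same block must not be inverted by `π`,
since the blocks are increasing. -/
def blockMaps {k s : ℕ} (π : Equiv.Perm (Fin k)) (ρ : Equiv.Perm (Fin s)) :
    Finset (Fin k → Fin s) :=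
  open Classical in
  Finset.univ.filter fun g => Monotone g ∧ ∀ i j, i < j → (π i > π j ↔ ρ (g i) > ρ (g j))

/-- Offsets within the blocks: for monotone `g`, a map that lies over `g` is strictly increasing if
and only if its offsets strictly increase on each fiber of `g`. -/
abbrev FiberOffsets {k s : ℕ} (g : Fin k → Fin s) (m : Fin s → ℕ) : Type :=
  {h : Fin k → ℕ // (∀ i, h i < m (g i)) ∧ ∀ i j, i < j → g i = g j → h i < h j}

instance {k s : ℕ} (g : Fin k → Fin s) (m : Fin s → ℕ) : Finite (FiberOffsets g m) :=
  Finite.of_injective (β := ∀ i, Fin (m (g i))) (fun h i => ⟨h.1 i, h.2.1 i⟩) fun h h' e =>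
    Subtype.ext (funext fun i => by simpa using congrFun e i)

theorem card_fiberOffsets {k s : ℕ} (g : Fin k → Fin s) (m : Fin s → ℕ) :
    Nat.card (FiberOffsets g m) = ∏ a, (m a).choose (fiberCard g a) := by
  let e : FiberOffsets g m ≃ ∀ a, ({i : Fin k // g i = a} ↪o Fin (m a)) :=
    { toFun := fun h a => OrderEmbedding.ofStrictMono
        (fun i => ⟨h.1 i, (h.2.1 i).trans_eq (by rw [i.2])⟩)
        (fun i j hij => h.2.2 i j hij (by rw [i.2, j.2]))
      invFun := fun F => ⟨fun i => F (g i) ⟨i, rfl⟩, fun i => Fin.isLt _, fun i j hij h => by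
        have key : ∀ b, ∀ hb : g i = b, (F (g i) ⟨i, rfl⟩ : ℕ) = F b ⟨i, hb⟩ := by
          rintro b rfl
          rfl
        change (F (g i) ⟨i, rfl⟩ : ℕ) < F (g j) ⟨j, rfl⟩
        rw [key (g j) h]
        exact Fin.lt_def.mp ((F (g j)).strictMono (Subtype.mk_lt_mk.mpr hij))⟩
      left_inv := fun h => by ext; rfl
      right_inv := fun F => by
        funext a
        ext ⟨i, hi⟩
        subst hi
        rfl }
  rw [Nat.card_congr e, Nat.card_pi]
  exact Finset.prod_congr rfl fun a _ => card_orderEmbedding_fin _ _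

/-- Inflating the points of `ρ` by increasing runs of lengths `m a`. -/
theorem exists_perm_inflation {s : ℕ} (ρ : Equiv.Perm (Fin s)) (m : Fin s → ℕ) :
    ∃ θ : Equiv.Perm (Fin (∑ a, m a)), ∀ (k : ℕ) (π : Equiv.Perm (Fin k)),
      (Occ π θ).ncard = ∑ g ∈ blockMaps π ρ, ∏ a, (m a).choose (fiberCard g a) := by
  let X : Type := {p : Fin s ×ₗ ℕ // (ofLex p).2 < m (ofLex p).1}
  let eX : X ≃ Σ a : Fin s, Fin (m a) :=
    { toFun := fun p => ⟨(ofLex p.1).1, ⟨(ofLex p.1).2, p.2⟩⟩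
      invFun := fun x => ⟨toLex (x.1, (x.2 : ℕ)), x.2.isLt⟩
      left_inv := fun p => rfl
      right_inv := fun x => rfl }
  let _ : Fintype X := Fintype.ofEquiv _ eX.symm
  let y : X → Fin s ×ₗ ℕ := fun p => toLex (ρ (ofLex p.1).1, (ofLex p.1).2)
  have hy : Function.Injective y := by
    rintro ⟨p, hp⟩ ⟨p', hp'⟩ h
    have h' := Prod.ext_iff.mp (toLex.injective h)
    exact Subtype.ext (ofLex.injective (Prod.ext (ρ.injective h'.1) h'.2))
  have hN : Fintype.card X = ∑ a, m a := by
    rw [Fintype.card_congr eX, Fintype.card_sigma]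
    simp
  obtain ⟨θ, hθ⟩ := exists_perm_ncard_occ_eq y hy hN
  refine ⟨θ, fun k π => ?_⟩
  rw [hθ, ← Nat.card_coe_set_eq]
  have hlt : ∀ p p' : X, p < p' ↔ (ofLex p.1).1 < (ofLex p'.1).1 ∨
      (ofLex p.1).1 = (ofLex p'.1).1 ∧ (ofLex p.1).2 < (ofLex p'.1).2 :=
    fun p p' => Prod.Lex.lt_iff
  have hylt : ∀ p p' : X, y p < y p' ↔ ρ (ofLex p.1).1 < ρ (ofLex p'.1).1 ∨
      (ofLex p.1).1 = (ofLex p'.1).1 ∧ (ofLex p.1).2 < (ofLex p'.1).2 :=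
    fun p p' => by rw [Prod.Lex.lt_iff]; simp [y]
  let e : PatternMaps π y ≃ Σ g : blockMaps π ρ, FiberOffsets g.1 m :=
    { toFun := fun f => ⟨⟨fun i => (ofLex (f.1 i).1).1, by
          obtain ⟨f, hf, hf'⟩ := f
          simp only [blockMaps, Finset.mem_filter, Finset.mem_univ, true_and]
          constructor
          · intro i j hij
            rcases hij.eq_or_lt with rfl | hij
            · exact le_rfl
            · have := (hlt _ _).mp (hf hij)
              grind
          · intro i j hij
            have h1 := (hlt _ _).mp (hf hij)
            rw [hf' i j, gt_iff_lt, hylt]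
            grind⟩,
        ⟨fun i => (ofLex (f.1 i).1).2, fun i => (f.1 i).2, fun i j hij h => by
          have := (hlt _ _).mp (f.2.1 hij)
          grind⟩⟩
      invFun := fun x => ⟨fun i => ⟨toLex (x.1.1 i, x.2.1 i), x.2.2.1 i⟩, by
        obtain ⟨⟨g, hg⟩, ⟨h, h1, h2⟩⟩ := x
        simp only [blockMaps, Finset.mem_filter, Finset.mem_univ, true_and] at hg
        obtain ⟨hg1, hg2⟩ := hg
        constructor
        · intro i j hij
          rw [hlt]
          exact (hg1 hij.le).lt_or_eq.imp_right fun h => ⟨h, h2 i j hij h⟩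
        · intro i j
          rw [gt_iff_lt, gt_iff_lt, hylt]
          dsimp only [ofLex_toLex]
          rcases lt_trichotomy i j with hij | rfl | hij
          · have := hg2 i j hij
            have := h2 i j hij
            grind
          · simp
          · have a1 := hg2 j i hij
            have a2 := h2 j i hij
            have a3 := π.injective.ne hij.ne
            have a4 := ρ.injective.eq_iff (a := g i) (b := g j)
            grind⟩
      left_inv := fun f => rfl
      right_inv := fun x => rfl }
  rw [Nat.card_congr e, Nat.card_sigma, ← Finset.sum_coe_sort (blockMaps π ρ)]
  exact Finset.sum_congr rfl fun g _ => card_fiberOffsets _ _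

/-! ### Monomorphism densities as a unitriangular image of the densities -/

/-- The inversions of a permutation. They are pairs of natural numbers, so that inversion sets of
permutations of different orders have the same type. -/
def inversionSet {k : ℕ} (π : Equiv.Perm (Fin k)) : Set (ℕ × ℕ) :=
  {p | ∃ i j : Fin k, (i : ℕ) = p.1 ∧ (j : ℕ) = p.2 ∧ i < j ∧ π i > π j}

theorem inversionSet_finite {k : ℕ} (π : Equiv.Perm (Fin k)) : (inversionSet π).Finite := by
  refine (Set.finite_range fun p : Fin k × Fin k => ((p.1 : ℕ), (p.2 : ℕ))).subset ?_
  rintro ⟨a, b⟩ ⟨i, j, rfl, rfl, _⟩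
  exact ⟨(i, j), rfl⟩

theorem mem_inversionSet {k : ℕ} {π : Equiv.Perm (Fin k)} {i j : Fin k} :
    ((i : ℕ), (j : ℕ)) ∈ inversionSet π ↔ i < j ∧ π i > π j := by
  constructor
  · rintro ⟨i', j', hi, hj, h⟩
    obtain rfl := Fin.ext hi
    obtain rfl := Fin.ext hj
    exact h
  · exact fun h => ⟨i, j, rfl, rfl, h⟩

theorem inversionSet_subset_iff {k : ℕ} {π ρ : Equiv.Perm (Fin k)} :
    inversionSet π ⊆ inversionSet ρ ↔ ∀ i j, i < j → π i > π j → ρ i > ρ j := by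
  constructor
  · exact fun h i j hij hπ => (mem_inversionSet.mp (h (mem_inversionSet.mpr ⟨hij, hπ⟩))).2
  · rintro h ⟨a, b⟩ ⟨i, j, rfl, rfl, hij, hπ⟩
    exact mem_inversionSet.mpr ⟨hij, h i j hij hπ⟩

theorem inversionSet_injective {k : ℕ} :
    Function.Injective (inversionSet : Equiv.Perm (Fin k) → Set (ℕ × ℕ)) := fun _ _ h =>
  perm_eq_of_inversions fun i j hij =>
    ⟨inversionSet_subset_iff.mp h.subset i j hij, inversionSet_subset_iff.mp h.superset i j hij⟩

/-- The image of a monomorphism of `π` carries exactly one pattern, and that pattern has at least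
the inversions of `π`. -/
theorem ncard_mon_eq_sum {k n : ℕ} (π : Equiv.Perm (Fin k)) (σ : Equiv.Perm (Fin n)) :
    open Classical in
    (Mon π σ).ncard =
      ∑ ρ : Equiv.Perm (Fin k), if inversionSet π ⊆ inversionSet ρ then (Occ ρ σ).ncard else 0 := by
  classical
  have hunion : Mon π σ = ⋃ ρ ∈ Finset.univ.filter
      (fun ρ : Equiv.Perm (Fin k) => inversionSet π ⊆ inversionSet ρ), Occ ρ σ := by
    ext f
    simp only [Set.mem_iUnion, Finset.mem_filter, Finset.mem_univ, true_and, exists_prop]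
    constructor
    · rintro ⟨⟨hf, hf'⟩, hinj⟩
      -- The pattern of `σ` on the image of `f`.
      let φ : Fin k → Fin n := fun i => σ (f i)
      have hφ : StrictMono (φ ∘ Tuple.sort φ) := (Tuple.monotone_sort φ).strictMono_of_injective
        ((σ.injective.comp hinj).comp (Tuple.sort φ).injective)
      have hρ : ∀ i j, (Tuple.sort φ).symm i > (Tuple.sort φ).symm j ↔ φ i > φ j := by
        intro i j
        rw [gt_iff_lt, ← hφ.lt_iff_lt]
        simp
      exact ⟨(Tuple.sort φ).symm,
        inversionSet_subset_iff.mpr fun i j hij h => (hρ i j).mpr (hf' i j hij h),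
        hf.strictMono_of_injective hinj, hρ⟩
    · rintro ⟨ρ, hρ, hf, hf'⟩
      refine ⟨⟨hf.monotone, fun i j hij h => ?_⟩, hf.injective⟩
      exact (hf' i j).mp (inversionSet_subset_iff.mp hρ i j hij h)
  have hdisj : ((Finset.univ.filter
      (fun ρ : Equiv.Perm (Fin k) => inversionSet π ⊆ inversionSet ρ) : Finset _) :
        Set (Equiv.Perm (Fin k))).PairwiseDisjoint (fun ρ => Occ ρ σ) := by
    intro ρ _ ρ' _ hne
    refine Set.disjoint_left.mpr fun f hf hf' => hne ?_
    exact perm_eq_of_inversions fun i j _ => (hf.2 i j).trans (hf'.2 i j).symm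
  rw [hunion, ← Finset.sum_filter]
  have := (Finset.finite_toSet _).ncard_biUnion (fun ρ _ => finite_occ ρ σ) hdisj
  rw [finsum_mem_coe_finset] at this
  simpa using this

/-- The matrix that expresses monomorphism densities through densities: its entry at `(p, p')` is
`1` if `p'` has the same order as `p` and at least its inversions, and `0` otherwise. -/
noncomputable def monMap (q : ℕ) :
    EuclideanSpace ℝ (IndecPerm q) →ₗ[ℝ] EuclideanSpace ℝ (IndecPerm q) :=
  open Classical in
  { toFun := fun v => WithLp.toLp 2 fun p => ∑ p' : IndecPerm q,
      if p.1.1 = p'.1.1 ∧ inversionSet p.1.2 ⊆ inversionSet p'.1.2 then v p' else 0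
    map_add' := fun v w => by
      ext p
      simp only [PiLp.add_apply, ← Finset.sum_add_distrib]
      exact Finset.sum_congr rfl fun p' _ => by split_ifs <;> simp
    map_smul' := fun c v => by
      ext p
      simp only [PiLp.smul_apply, smul_eq_mul, RingHom.id_apply, Finset.mul_sum]
      exact Finset.sum_congr rfl fun p' _ => by split_ifs <;> simp }

theorem monMap_apply (q : ℕ) (v : EuclideanSpace ℝ (IndecPerm q)) (p : IndecPerm q) :
    open Classical in
    monMap q v p = ∑ p' : IndecPerm q,
      if p.1.1 = p'.1.1 ∧ inversionSet p.1.2 ⊆ inversionSet p'.1.2 then v p' else 0 := rfl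

theorem monDensityVec_eq (q : ℕ) {n : ℕ} (σ : Equiv.Perm (Fin n)) :
    monDensityVec q σ = monMap q (densityVec q σ) := by
  classical
  ext p
  rw [monMap_apply]
  obtain ⟨⟨k, π⟩, hk, hπ⟩ := p
  simp only [monDensityVec, densityVec]
  -- Only indecomposable permutations of order `k` contribute to either side.
  have hsum : ∑ p' : IndecPerm q,
      (if k = p'.1.1 ∧ inversionSet π ⊆ inversionSet p'.1.2 then density p'.1.2 σ else 0) =
      ∑ ρ : Equiv.Perm (Fin k), if inversionSet π ⊆ inversionSet ρ then density ρ σ else 0 := by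
    rw [← Finset.sum_filter, ← Finset.sum_filter]
    symm
    refine Finset.sum_bij (fun ρ hρ => ⟨⟨k, ρ⟩, hk, hπ.of_inversions_subset
      (inversionSet_subset_iff.mp (Finset.mem_filter.mp hρ).2)⟩) ?_ ?_ ?_ ?_
    · intro ρ hρ
      simpa using hρ
    · intro ρ _ ρ' _ h
      simpa using h
    · rintro ⟨⟨k', ρ⟩, h1, h2⟩ h
      simp only [Finset.mem_filter, Finset.mem_univ, true_and] at h
      obtain ⟨rfl, h⟩ := h
      exact ⟨ρ, by simpa using h, rfl⟩
    · intro ρ _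
      rfl
  refine Eq.trans ?_ hsum.symm
  unfold monDensity density
  split_ifs with hkn
  · rw [ncard_mon_eq_sum]
    push_cast
    rw [Finset.sum_div]
    exact Finset.sum_congr rfl fun ρ _ => by split_ifs <;> simp
  · simp

theorem monMap_injective (q : ℕ) : Function.Injective (monMap q) := by
  classical
  rw [injective_iff_map_eq_zero]
  intro v hv
  by_contra hne
  -- At a permutation in the support of `v` with the most inversions only the diagonal entry acts.
  have hsupp : (Finset.univ.filter fun p => v p ≠ 0).Nonempty := by
    by_contra h
    refine hne (PiLp.ext fun p => ?_)
    by_contra hp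
    exact h ⟨p, by simpa using hp⟩
  obtain ⟨p, hp, hmax⟩ := Finset.exists_max_image _
    (fun p : IndecPerm q => (inversionSet p.1.2).ncard) hsupp
  have hvp : v p ≠ 0 := by simpa using hp
  refine hvp ?_
  have h := congrArg (fun w : EuclideanSpace ℝ (IndecPerm q) => w p) hv
  simp only [monMap_apply] at h
  rw [Finset.sum_eq_single p] at h
  · simpa using h
  · rintro p' - hp'
    rw [ite_eq_right_iff]
    rintro ⟨hk, hsub⟩
    by_contra hv'
    have hle := hmax p' (by simpa using hv')
    have heq := Set.eq_of_subset_of_ncard_le hsub hle (inversionSet_finite _)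
    obtain ⟨⟨k, π⟩, h1, h2⟩ := p
    obtain ⟨⟨k', π'⟩, h1', h2'⟩ := p'
    obtain rfl : k = k' := hk
    obtain rfl : π = π' := inversionSet_injective heq
    exact hp' rfl
  · simp

/-! ### Limits of occurrence counts along sequences of permutations -/

/-- There are permutations `σ n` of orders asymptotic to `W * n` in which every indecomposable `τ`
of order `k` has `(p τ + o(1)) * n ^ k` occurrences. In contrast to densities, these limits are
additive under direct sums. -/
def HasLimitCounts (q : ℕ) (p : IndecPerm q → ℝ) (W : ℝ) : Prop :=
  ∃ (N : ℕ → ℕ) (σ : (n : ℕ) → Equiv.Perm (Fin (N n))),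
    Tendsto (fun n => (N n : ℝ) / n) atTop (𝓝 W) ∧
    ∀ τ : IndecPerm q, Tendsto
      (fun n => ((Occ τ.1.2 (σ n)).ncard : ℝ) / (n : ℝ) ^ (τ.1.1 : ℕ)) atTop (𝓝 (p τ))

theorem HasLimitCounts.add {q : ℕ} {p p' : IndecPerm q → ℝ} {W W' : ℝ}
    (h : HasLimitCounts q p W) (h' : HasLimitCounts q p' W') :
    HasLimitCounts q (p + p') (W + W') := by
  obtain ⟨N, σ, hN, hσ⟩ := h
  obtain ⟨N', σ', hN', hσ'⟩ := h'
  choose θ hθ using fun n => exists_perm_directSum (σ n) (σ' n)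
  refine ⟨fun n => N n + N' n, θ, ?_, fun τ => ?_⟩
  · simpa [add_div] using hN.add hN'
  · refine ((hσ τ).add (hσ' τ)).congr fun n => ?_
    rw [hθ n _ _ τ.2.1.le τ.2.2]
    push_cast
    rw [add_div]

theorem HasLimitCounts.scale {q : ℕ} {p : IndecPerm q → ℝ} {W : ℝ} (h : HasLimitCounts q p W)
    {z : ℝ} (hz : 0 < z) :
    HasLimitCounts q (fun τ => z ^ (τ.1.1 : ℕ) * p τ) (z * W) := by
  obtain ⟨N, σ, hN, hσ⟩ := h
  have hfl : Tendsto (fun n : ℕ => ⌊z * n⌋₊) atTop atTop :=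
    tendsto_nat_floor_atTop.comp (tendsto_natCast_atTop_atTop.const_mul_atTop hz)
  have hdiv : Tendsto (fun n : ℕ => (⌊z * n⌋₊ : ℝ) / n) atTop (𝓝 z) :=
    (tendsto_nat_floor_mul_div_atTop hz.le).comp tendsto_natCast_atTop_atTop
  have hne : ∀ᶠ n : ℕ in atTop, (⌊z * n⌋₊ : ℝ) ≠ 0 := by
    filter_upwards [hfl.eventually_ge_atTop 1] with n hn
    exact_mod_cast (by omega : ⌊z * n⌋₊ ≠ 0)
  refine ⟨fun n => N ⌊z * n⌋₊, fun n => σ ⌊z * n⌋₊, ?_, fun τ => ?_⟩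
  · refine (hdiv.mul (hN.comp hfl)).congr' ?_
    filter_upwards [hne] with n hn
    simp only [Function.comp]
    field_simp
  · refine ((hdiv.pow _).mul ((hσ τ).comp hfl)).congr' ?_
    filter_upwards [hne] with n hn
    simp only [Function.comp]
    rw [div_pow]
    field_simp

theorem occ_one_eq_empty {k n : ℕ} {π : Equiv.Perm (Fin k)} (hk : 1 < k)
    (hπ : IsIndecomposable π) : Occ π (1 : Equiv.Perm (Fin n)) = ∅ := by
  rw [Set.eq_empty_iff_forall_notMem]
  rintro f ⟨hf, hf'⟩
  obtain ⟨i, j, hi, hj, hij⟩ := hπ.exists_inversion le_rfl hk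
  have h1 := (hf' i j).mp hij
  have h2 : f i < f j := hf (Fin.lt_def.mpr (hi.trans_le hj))
  exact lt_asymm h1 h2

theorem hasLimitCounts_zero_one (q : ℕ) : HasLimitCounts q 0 1 := by
  refine ⟨fun n => n, fun n => 1, ?_, fun τ => ?_⟩
  · refine tendsto_const_nhds.congr' ?_
    filter_upwards [eventually_ne_atTop 0] with n hn
    rw [div_self]
    exact_mod_cast hn
  · simp [occ_one_eq_empty τ.2.1 τ.2.2]

/-- A finite combination of scaled limits, filled up by an identity permutation of relative size
`1 - ∑ z i * W i`. -/
theorem HasLimitCounts.sum_scale {q : ℕ} {ι : Type*} (s : Finset ι) {p : ι → IndecPerm q → ℝ}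
    {W : ι → ℝ} (h : ∀ i ∈ s, HasLimitCounts q (p i) (W i)) {z : ι → ℝ} (hz : ∀ i ∈ s, 0 < z i)
    (hlt : ∑ i ∈ s, z i * W i < 1) :
    HasLimitCounts q (fun τ => ∑ i ∈ s, z i ^ (τ.1.1 : ℕ) * p i τ) 1 := by
  classical
  have key : ∀ {r : ℝ}, 0 < r → HasLimitCounts q (fun τ => ∑ i ∈ s, z i ^ (τ.1.1 : ℕ) * p i τ)
      (r + ∑ i ∈ s, z i * W i) := by
    intro r hr
    clear hlt
    induction s using Finset.induction_on with
    | empty => simpa using (hasLimitCounts_zero_one q).scale hr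
    | insert a s ha ih =>
      have h1 := ih (fun i hi => h i (Finset.mem_insert_of_mem hi))
        (fun i hi => hz i (Finset.mem_insert_of_mem hi))
      have h2 := (h a (Finset.mem_insert_self _ _)).scale (hz a (Finset.mem_insert_self _ _))
      have h3 := h2.add h1
      rw [Finset.sum_insert ha]
      convert h3 using 1
      · ext τ
        rw [Finset.sum_insert ha]
        rfl
      · ring
  have := key (sub_pos.mpr hlt)
  simpa using this

theorem tendsto_choose_div_pow {m : ℕ → ℕ} {w : ℝ} (hw : 0 < w)
    (hm : Tendsto (fun n => (m n : ℝ) / n) atTop (𝓝 w)) (c : ℕ) :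
    Tendsto (fun n => ((m n).choose c : ℝ) / (n : ℝ) ^ c) atTop (𝓝 (w ^ c / c.factorial)) := by
  have hmtop : Tendsto m atTop atTop := by
    have h : Tendsto (fun n : ℕ => (m n : ℝ) / n * n) atTop atTop :=
      hm.pos_mul_atTop hw tendsto_natCast_atTop_atTop
    refine tendsto_natCast_atTop_iff.mp (h.congr' ?_)
    filter_upwards [eventually_ne_atTop 0] with n hn
    have : (n : ℝ) ≠ 0 := by exact_mod_cast hn
    field_simp
  have h1 : Tendsto (fun x : ℕ => (x.choose c : ℝ) / ((x : ℝ) ^ c / c.factorial)) atTop (𝓝 1) := by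
    refine (Asymptotics.isEquivalent_iff_tendsto_one ?_).mp (isEquivalent_choose c)
    filter_upwards [eventually_ne_atTop 0] with n hn
    have : (n : ℝ) ≠ 0 := by exact_mod_cast hn
    positivity
  have h2 := (h1.comp hmtop).mul ((hm.pow c).div_const (c.factorial : ℝ))
  rw [one_mul] at h2
  refine h2.congr' ?_
  filter_upwards [hmtop.eventually_ne_atTop 0] with n hn
  have : (m n : ℝ) ≠ 0 := by exact_mod_cast hn
  have : (c.factorial : ℝ) ≠ 0 := by exact_mod_cast c.factorial_ne_zero
  simp only [Function.comp, div_pow]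
  field_simp

theorem HasLimitCounts.mem_limitDensities {q : ℕ} {p : IndecPerm q → ℝ}
    (h : HasLimitCounts q p 1) :
    (WithLp.toLp 2 fun τ => ((τ.1.1 : ℕ).factorial : ℝ) * p τ) ∈ limitDensities q := by
  obtain ⟨N, σ, hN, hσ⟩ := h
  have hNtop : Tendsto N atTop atTop := by
    have h : Tendsto (fun n : ℕ => (N n : ℝ) / n * n) atTop atTop :=
      hN.pos_mul_atTop one_pos tendsto_natCast_atTop_atTop
    refine tendsto_natCast_atTop_iff.mp (h.congr' ?_)
    filter_upwards [eventually_ne_atTop 0] with n hn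
    have : (n : ℝ) ≠ 0 := by exact_mod_cast hn
    field_simp
  refine ⟨N, σ, hNtop, ?_⟩
  refine ((PiLp.continuous_toLp 2 _).tendsto _).comp (tendsto_pi_nhds.mpr fun τ => ?_)
  have h1 := (hσ τ).div (tendsto_choose_div_pow one_pos hN τ.1.1) (by positivity)
  rw [one_pow, div_div_eq_mul_div, div_one, mul_comm] at h1
  refine h1.congr' ?_
  filter_upwards [eventually_ne_atTop 0, hNtop.eventually_ge_atTop (τ.1.1 : ℕ)] with n hn hk
  have : (n : ℝ) ≠ 0 := by exact_mod_cast hn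
  simp only [density, if_pos hk, Pi.div_apply]
  field_simp

theorem sum_fiberCard {k s : ℕ} (g : Fin k → Fin s) : ∑ a, fiberCard g a = k := by
  simp only [fiberCard, Fintype.card_subtype]
  rw [← Finset.card_eq_sum_card_fiberwise (fun _ _ => Finset.mem_univ _), Finset.card_fin]

/-- The limiting number of occurrences in inflations of `ρ`, as a function of the weights. -/
theorem hasLimitCounts_inflation (q : ℕ) {s : ℕ} (ρ : Equiv.Perm (Fin s)) {w : Fin s → ℝ}
    (hw : ∀ a, 0 < w a) :
    HasLimitCounts q (fun τ => ∑ g ∈ blockMaps τ.1.2 ρ,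
      ∏ a, w a ^ fiberCard g a / (fiberCard g a).factorial) (∑ a, w a) := by
  choose θ hθ using fun n : ℕ => exists_perm_inflation ρ fun a => ⌊w a * n⌋₊
  have hdiv : ∀ a, Tendsto (fun n : ℕ => (⌊w a * n⌋₊ : ℝ) / n) atTop (𝓝 (w a)) := fun a =>
    (tendsto_nat_floor_mul_div_atTop (hw a).le).comp tendsto_natCast_atTop_atTop
  refine ⟨_, θ, ?_, fun τ => ?_⟩
  · refine (tendsto_finsetSum _ fun a _ => hdiv a).congr fun n => ?_
    push_cast
    rw [Finset.sum_div]
  · simp only [hθ]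
    refine (tendsto_finsetSum _ fun g _ => tendsto_finsetProd _ fun a _ =>
      tendsto_choose_div_pow (hw a) (hdiv a) (fiberCard g a)).congr fun n => ?_
    push_cast
    rw [Finset.sum_div]
    refine Finset.sum_congr rfl fun g _ => ?_
    rw [Finset.prod_div_distrib, Finset.prod_pow_eq_pow_sum, sum_fiberCard]

/-! ### The limit vectors span the whole space -/

theorem fiberCard_id {s : ℕ} (a : Fin s) : fiberCard id a = 1 := by
  simp [fiberCard]

theorem id_mem_blockMaps {s : ℕ} (ρ : Equiv.Perm (Fin s)) : id ∈ blockMaps ρ ρ := by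
  simp [blockMaps, monotone_id]

/-- A block map that meets every block exactly once identifies `π` with `ρ`. -/
theorem eq_of_fiberCard_eq_one {s : ℕ} {π ρ : Equiv.Perm (Fin s)} {g : Fin s → Fin s}
    (hg : g ∈ blockMaps π ρ) (h1 : ∀ a, fiberCard g a = 1) : g = id ∧ π = ρ := by
  simp only [blockMaps, Finset.mem_filter, Finset.mem_univ, true_and] at hg
  have hinj : Function.Injective g := by
    intro i j hij
    have := Fintype.card_le_one_iff.mp (h1 (g j)).le ⟨i, hij⟩ ⟨j, rfl⟩
    simpa using this
  have hid : g = id := ((hg.1.strictMono_of_injective hinj).range_inj strictMono_id).mp (by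
    rw [(Finite.injective_iff_surjective.mp hinj).range_eq, Set.range_id])
  subst hid
  exact ⟨rfl, perm_eq_of_inversions hg.2⟩

/-- A linear relation between the limit counts that holds in all inflations of `τ₀` does not
involve `τ₀`: the squarefree monomial in all weights occurs only in the polynomial of `τ₀`. -/
theorem coeff_eq_zero_of_forall_sum_eq_zero {q : ℕ} (c : IndecPerm q → ℝ) (τ₀ : IndecPerm q)
    (h : ∀ w : Fin τ₀.1.1 → ℝ, (∀ a, 0 < w a) → ∑ τ, c τ * ∑ g ∈ blockMaps τ.1.2 τ₀.1.2,
      ∏ a, w a ^ fiberCard g a / (fiberCard g a).factorial = 0) : c τ₀ = 0 := by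
  classical
  let E : (Fin τ₀.1.1 → ℕ) ≃ (Fin τ₀.1.1 →₀ ℕ) := Finsupp.equivFunOnFinite.symm
  let Q : MvPolynomial (Fin τ₀.1.1) ℝ := ∑ τ : IndecPerm q, ∑ g ∈ blockMaps τ.1.2 τ₀.1.2,
    MvPolynomial.monomial (E (fiberCard g)) (c τ * ∏ a, ((fiberCard g a).factorial : ℝ)⁻¹)
  have hQ : Q = 0 := by
    refine MvPolynomial.funext_set (fun _ => Set.Ioi (0 : ℝ)) (fun _ => Set.Ioi_infinite 0) fun w hw => ?_
    rw [map_zero, ← h w fun a => hw a (Set.mem_univ a)]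
    simp only [Q, map_sum, MvPolynomial.eval_monomial]
    refine Finset.sum_congr rfl fun τ _ => ?_
    rw [Finset.mul_sum]
    refine Finset.sum_congr rfl fun g _ => ?_
    rw [Finsupp.prod_fintype _ _ (by simp), mul_assoc, ← Finset.prod_mul_distrib]
    congr 1
    refine Finset.prod_congr rfl fun a _ => ?_
    rw [div_eq_inv_mul]
    rfl
  have hcoeff : Q.coeff (E fun _ => 1) = c τ₀ := by
    simp only [Q, MvPolynomial.coeff_sum, MvPolynomial.coeff_monomial, E.injective.eq_iff]
    rw [Finset.sum_eq_single τ₀, Finset.sum_eq_single id, if_pos (funext fiberCard_id)]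
    · simp [fiberCard_id]
    · intro g hg hne
      rw [if_neg]
      exact fun h1 => hne (eq_of_fiberCard_eq_one hg (congrFun h1)).1
    · exact fun hid => absurd (id_mem_blockMaps _) hid
    · intro τ _ hne
      refine Finset.sum_eq_zero fun g hg => ?_
      rw [if_neg]
      intro h1
      have hk : (τ.1.1 : ℕ) = τ₀.1.1 := by
        rw [← sum_fiberCard g, h1]
        simp
      obtain ⟨⟨k, π⟩, h2, h3⟩ := τ
      obtain ⟨⟨k₀, π₀⟩, h2', h3'⟩ := τ₀
      obtain rfl : k = k₀ := Fin.ext hk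
      obtain rfl := (eq_of_fiberCard_eq_one hg (congrFun h1)).2
      exact hne rfl
    · simp
  rw [← hcoeff, hQ, MvPolynomial.coeff_zero]

theorem span_hasLimitCounts (q : ℕ) :
    Submodule.span ℝ {p : IndecPerm q → ℝ | ∃ W, HasLimitCounts q p W} = ⊤ := by
  classical
  by_contra hne
  obtain ⟨f, hf, hker⟩ := Submodule.exists_le_ker_of_lt_top _ (lt_top_iff_ne_top.mpr hne)
  refine hf (LinearMap.pi_ext' fun τ₀ => LinearMap.ext_ring ?_)
  have hexp : ∀ v : IndecPerm q → ℝ, f v = ∑ τ, f (Pi.single τ 1) * v τ := by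
    intro v
    rw [LinearMap.pi_apply_eq_sum_univ f v]
    refine Finset.sum_congr rfl fun τ _ => ?_
    rw [smul_eq_mul, mul_comm]
    congr 2
    ext τ'
    simp [Pi.single_apply, eq_comm]
  refine coeff_eq_zero_of_forall_sum_eq_zero (fun τ => f (Pi.single τ 1)) τ₀ fun w hw => ?_
  rw [← hexp (fun τ => _)]
  exact hker (Submodule.subset_span ⟨_, hasLimitCounts_inflation q τ₀.1.2 hw⟩)

/-! ### Interior points and independence -/

theorem exists_mem_nhds_limitDensities (q : ℕ) : ∃ w, limitDensities q ∈ 𝓝 w := by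
  classical
  obtain ⟨t, hts, ht⟩ := (Submodule.fg_span_iff_fg_span_finset_subset _).mp
    ((span_hasLimitCounts q).symm ▸ (Module.Finite.fg_top : (⊤ : Submodule ℝ (IndecPerm q → ℝ)).FG))
  rw [span_hasLimitCounts] at ht
  choose W hW using fun p : t => hts p.2
  -- The scales of the summands are the parameters; `ζ` makes the total relative size less than `1`.
  let ζ : ℝ := (1 + ∑ p, |W p|)⁻¹
  have hden : 0 < 1 + ∑ p, |W p| := by positivity
  have hζ : 0 < ζ := inv_pos.mpr hden
  let z₀ : t → ℝ := fun _ => ζ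
  let F : (t → ℝ) → IndecPerm q → ℝ := fun z τ =>
    ((τ.1.1 : ℕ).factorial : ℝ) * ∑ p : t, z p ^ (τ.1.1 : ℕ) * p.1 τ
  let F' : (t → ℝ) →L[ℝ] IndecPerm q → ℝ := ContinuousLinearMap.pi fun τ =>
    ((τ.1.1 : ℕ).factorial : ℝ) • ∑ p : t, p.1 τ •
      (((τ.1.1 : ℕ) : ℝ) * ζ ^ ((τ.1.1 : ℕ) - 1)) • ContinuousLinearMap.proj (R := ℝ) p
  have hF : HasStrictFDerivAt F F' z₀ := by
    refine hasStrictFDerivAt_pi.mpr fun τ => ?_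
    refine HasStrictFDerivAt.const_mul (HasStrictFDerivAt.fun_sum fun p _ => ?_) _
    refine HasStrictFDerivAt.mul_const ?_ _
    have := (hasStrictFDerivAt_apply (𝕜 := ℝ) p z₀).pow (τ.1.1 : ℕ)
    simpa using this
  have hsurj : Function.Surjective F' := by
    intro b
    let d : IndecPerm q → ℝ := fun τ =>
      ((τ.1.1 : ℕ).factorial : ℝ) * (((τ.1.1 : ℕ) : ℝ) * ζ ^ ((τ.1.1 : ℕ) - 1))
    have hd : ∀ τ, d τ ≠ 0 := fun τ => by
      have : (0 : ℝ) < (τ.1.1 : ℕ) := by exact_mod_cast (zero_lt_one.trans τ.2.1)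
      positivity
    have hmem : (fun τ => b τ / d τ) ∈ Submodule.span ℝ (Set.range fun p : t => p.1) := by
      rw [Subtype.range_coe_subtype]
      exact ht ▸ Submodule.mem_top
    obtain ⟨x, hx⟩ := (Submodule.mem_span_range_iff_exists_fun ℝ).mp hmem
    refine ⟨x, funext fun τ => ?_⟩
    have hxτ := congrFun hx τ
    rw [eq_div_iff (hd τ)] at hxτ
    rw [← hxτ]
    simp only [F', d, ContinuousLinearMap.pi_apply, smul_apply,
      sum_apply, ContinuousLinearMap.proj_apply, smul_eq_mul,
      Finset.sum_apply, Pi.smul_apply, Finset.mul_sum, Finset.sum_mul]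
    exact Finset.sum_congr rfl fun p _ => by ring
  have hregion : {z : t → ℝ | (∀ p, 0 < z p) ∧ ∑ p, z p * W p < 1} ∈ 𝓝 z₀ := by
    have hpos : ∀ᶠ z in 𝓝 z₀, ∀ p, 0 < z p := eventually_all.mpr fun p =>
      (continuous_apply p).continuousAt.eventually_const_lt hζ
    have hsum : Continuous fun z : t → ℝ => ∑ p, z p * W p := by fun_prop
    refine hpos.and (hsum.continuousAt.eventually_lt_const ?_)
    change ∑ p, ζ * W p < 1
    rw [← Finset.mul_sum, inv_mul_lt_iff₀ hden, mul_one]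
    have : ∑ p, W p ≤ ∑ p, |W p| := Finset.sum_le_sum fun p _ => le_abs_self _
    linarith
  have himage := Filter.image_mem_map (m := F) hregion
  rw [hF.map_nhds_eq_of_surj (LinearMap.range_eq_top.mpr hsurj)] at himage
  refine ⟨WithLp.toLp 2 (F z₀), ?_⟩
  have hofLp := (PiLp.continuous_ofLp 2 (fun _ : IndecPerm q => ℝ)).tendsto (WithLp.toLp 2 (F z₀))
  refine mem_of_superset (hofLp himage) ?_
  rintro v ⟨z, ⟨hz, hlt⟩, hzv⟩
  have := (HasLimitCounts.sum_scale Finset.univ (fun p _ => hW p) (fun p _ => hz p)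
    hlt).mem_limitDensities
  rw [← WithLp.toLp_ofLp (p := 2) v, ← hzv]
  exact this

theorem exists_mem_nhds_limitMonDensities (q : ℕ) : ∃ w, limitMonDensities q ∈ 𝓝 w := by
  obtain ⟨w, hw⟩ := exists_mem_nhds_limitDensities q
  let e := (LinearEquiv.ofInjectiveEndo (monMap q) (monMap_injective q)).toContinuousLinearEquiv
  refine ⟨e w, mem_of_superset (e.toHomeomorph.isOpenMap.image_mem_nhds hw) ?_⟩
  rintro _ ⟨v, ⟨N, σ, hN, hσ⟩, rfl⟩
  refine ⟨N, σ, hN, ?_⟩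
  simp only [monDensityVec_eq]
  exact (e.continuous.tendsto v).comp hσ

/-- A set with an interior point contains two points that differ in a prescribed coordinate only. -/
theorem coordsIndependent_of_mem_nhds {ι : Type*} [Fintype ι] {T : Set (EuclideanSpace ℝ ι)}
    {w : EuclideanSpace ℝ ι} (hT : T ∈ 𝓝 w) : CoordsIndependent T := by
  classical
  rintro i ⟨g, hg⟩
  have hcont : Tendsto (fun x : ℝ => w + x • EuclideanSpace.single i (1 : ℝ)) (𝓝 0) (𝓝 w) := by
    have : Continuous fun x : ℝ => w + x • EuclideanSpace.single i (1 : ℝ) := by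
      fun_prop
    simpa using this.tendsto 0
  obtain ⟨x, hx, hx0⟩ := ((hcont.mono_left nhdsWithin_le_nhds).eventually hT |>.and
    (self_mem_nhdsWithin : {x : ℝ | x ≠ 0} ∈ 𝓝[≠] (0 : ℝ))).exists
  have h1 := hg _ hx
  have h2 := hg _ (mem_of_mem_nhds hT)
  have h3 : (fun j : {j : ι // j ≠ i} => (w + x • EuclideanSpace.single i (1 : ℝ)) j.1) = fun j => w j.1 := by
    ext j
    simp [j.2]
  rw [h3, ← h2] at h1
  exact hx0 (by simpa using h1)

theorem ball_interior_coordsIndependent {ι : Type*} [Fintype ι] {T : Set (EuclideanSpace ℝ ι)}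
    (hT : ∃ w, T ∈ 𝓝 w) :
    (∃ w ∈ T, ∃ ε : ℝ, 0 < ε ∧ Metric.ball w ε ⊆ T) ∧ (interior T).Nonempty ∧
      CoordsIndependent T := by
  obtain ⟨w, hw⟩ := hT
  exact ⟨⟨w, mem_of_mem_nhds hw, Metric.mem_nhds_iff.mp hw⟩, ⟨w, mem_interior_iff_mem_nhds.mpr hw⟩,
    coordsIndependent_of_mem_nhds hw⟩

theorem theorem1 (q : ℕ) (hq : 2 ≤ q) :
    ((∃ w ∈ limitDensities q, ∃ ε : ℝ, 0 < ε ∧ Metric.ball w ε ⊆ limitDensities q) ∧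
      (interior (limitDensities q)).Nonempty ∧
      CoordsIndependent (limitDensities q)) ∧
    ((∃ w ∈ limitMonDensities q, ∃ ε : ℝ, 0 < ε ∧ Metric.ball w ε ⊆ limitMonDensities q) ∧
      (interior (limitMonDensities q)).Nonempty ∧
      CoordsIndependent (limitMonDensities q)) := by
  exact ⟨ball_interior_coordsIndependent (exists_mem_nhds_limitDensities q),
    ball_interior_coordsIndependent (exists_mem_nhds_limitMonDensities q)⟩
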